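/- Let $G$ be a finite group acting linearly on the unit sphere $S^n\subset\mathbb{R}^{n+1}$, $n \ge 0$ (every $g\in G$ acts as the restriction of a linear, hence orthogonal, map of $\mathbb{R}^{n+1}$). Suppose that $S^n$ is $G$-connected, i.e. for every subgroup $H\subseteq G$ the fixed point set $(S^n)^H$ is path-connected, and that $(S^n)^G\neq\emptyset$. Then \[ 2\le TC_G(S^n)\le 3 \qquad\text{and}\qquad 2\le TC^G(S^n)\le 3 . \] Here, for a $G$-space $X$, let $PX$ be the space of continuous paths $[0,1]\to X$ with the compact-open topology and the action $(g\gamma)(t)=g(\gamma(t))$. The equivariant topological complexity $TC_G(X)$ is the least integer $k\ge 1$ such that $X\times X$ is covered by $k$ open sets $U$, each invariant under the diagonal action $g(x,y)=(gx,gy)$ and each admitting a continuous $G$-equivariant map $s\colon U\to PX$ such that $s(x,y)$ is a path from $x$ to $y$ for all $(x,y)\in U$. The invariant topological complexity $TC^G(X)$ is the least integer $k\ge 1$ such that $X\times X$ is covered by $k$ open sets $U$, each invariant under the action $(g_1,g_2)(x,y)=(g_1x,g_2y)$ of $G\times G$ and each admitting a continuous $(G\times G)$-equivariant map \[ s\colon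 U\to PX\times_{X/G}PX=\{(\gamma,\delta)\in PX\times PX : G\gamma(1)=G\delta(0)\} \] such that $s(x,y)=(\gamma,\delta)$ satisfies $\gamma(0)=x$ and $\delta(1)=y$ for all $(x,y)\in U$; here $G\times G$ acts on $PX\times_{X/G}PX$ by $(g_1,g_2)(\gamma,\delta)=(g_1\gamma,g_2\delta)$, and the target carries the subspace topology. Both numbers are $\infty$ if no such $k$ exists. -/

import Mathlib

open scoped unitInterval

namespace EquivariantTC

/-- The space `PX` of all continuous paths in `X`, with the compact-open topology. If `G` acts on
`X` by continuous maps, then `G` acts on `PX` by `(g • γ) t = g • γ t`. -/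
abbrev PathSpace (X : Type*) [TopologicalSpace X] : Type _ := C(I, X)

section Connected

variable (G X : Type*) [Group G] [TopologicalSpace X] [MulAction G X]

/-- `X` is `G`-connected: the fixed point set of every subgroup `H` of `G` is path-connected
(the empty set is not excluded here). Used for finite, hence discrete, `G`, where every subgroup is
closed. -/
def GConnected : Prop :=
  ∀ H : Subgroup G, (MulAction.fixedPoints H X).Nonempty →
    IsPathConnected (MulAction.fixedPoints H X)

end Connected

section Equivariant

variable (G X : Type*) [Group G] [TopologicalSpace X] [MulAction G X] [ContinuousConstSMul G X]

/-- `U ⊆ X × X` is open, invariant under the diagonal action of `G`, and carries a `G`-equivariant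
motion planner, i.e. a `G`-equivariant continuous section over `U` of
`PX → X × X, γ ↦ (γ 0, γ 1)`. -/
def IsEquivariantDomain (U : Set (X × X)) : Prop :=
  IsOpen U ∧ (∀ (g : G), ∀ z ∈ U, g • z ∈ U) ∧
    ∃ s : C(U, PathSpace X),
      (∀ z : U, (s z 0, s z 1) = (z : X × X)) ∧
      ∀ (g : G) (z : U) (hz : g • (z : X × X) ∈ U), s ⟨g • (z : X × X), hz⟩ = g • s z

/-- The equivariant topological complexity `TC_G(X)` (non-reduced): the least `k ≥ 1` such that
`X × X` is covered by `k` open `G`-invariant sets with `G`-equivariant motion planners, and `⊤` if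
there is no such `k`. -/
noncomputable def equivariantTC : ℕ∞ :=
  sInf {m : ℕ∞ | ∃ k : ℕ, m = k ∧ 1 ≤ k ∧ ∃ U : Fin k → Set (X × X),
    (⋃ i, U i) = Set.univ ∧ ∀ i, IsEquivariantDomain G X (U i)}

end Equivariant

section Invariant

variable (G X : Type*) [Group G] [TopologicalSpace X] [MulAction G X]

/-- The space of pairs `(γ, δ)` of paths in `X` such that `γ 1` and `δ 0` lie in one `G`-orbit,
topologized as a subspace of `PX × PX`. -/
abbrev BrokenPathSpace : Type _ :=
  {p : PathSpace X × PathSpace X // MulAction.orbit G (p.1 1) = MulAction.orbit G (p.2 0)}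

variable [ContinuousConstSMul G X]

/-- The action of `G × G` on the broken paths, `(g₁, g₂) (γ, δ) = (g₁ γ, g₂ δ)`. -/
instance : MulAction (G × G) (BrokenPathSpace G X) where
  smul g p := ⟨(g.1 • p.1.1, g.2 • p.1.2), by
    have h := p.2
    simpa only [ContinuousMap.smul_apply, MulAction.orbit_smul] using h⟩
  one_smul p := Subtype.ext (Prod.ext (one_smul G p.1.1) (one_smul G p.1.2))
  mul_smul g h p :=
    Subtype.ext (Prod.ext (mul_smul g.1 h.1 p.1.1) (mul_smul g.2 h.2 p.1.2))

/-- `U ⊆ X × X` is open, invariant under the action `(g₁, g₂) (x, y) = (g₁ x, g₂ y)` of `G × G`,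
and carries a `(G × G)`-equivariant continuous section of the map `(γ, δ) ↦ (γ 0, δ 1)` from the
broken paths to `X × X`. -/
def IsInvariantDomain (U : Set (X × X)) : Prop :=
  IsOpen U ∧ (∀ g : G × G, ∀ z ∈ U, (g.1 • z.1, g.2 • z.2) ∈ U) ∧
    ∃ s : C(U, BrokenPathSpace G X),
      (∀ z : U, ((s z).1.1 0, (s z).1.2 1) = (z : X × X)) ∧
      ∀ (g : G × G) (z : U) (hz : (g.1 • (z : X × X).1, g.2 • (z : X × X).2) ∈ U),
        s ⟨(g.1 • (z : X × X).1, g.2 • (z : X × X).2), hz⟩ = g • s z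

/-- The invariant topological complexity `TC^G(X)` (non-reduced): the least `k ≥ 1` such that
`X × X` is covered by `k` open `(G × G)`-invariant sets with sections as above, and `⊤` if there is
no such `k`. -/
noncomputable def invariantTC : ℕ∞ :=
  sInf {m : ℕ∞ | ∃ k : ℕ, m = k ∧ 1 ≤ k ∧ ∃ U : Fin k → Set (X × X),
    (⋃ i, U i) = Set.univ ∧ ∀ i, IsInvariantDomain G X (U i)}

end Invariant

/-- The unit sphere `S^n` in the Euclidean space `ℝ^(n+1)`. -/
abbrev UnitSphere (n : ℕ) : Type :=
  Metric.sphere (0 : EuclideanSpace ℝ (Fin (n + 1))) 1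

/-- The action of `G` on `S^n` is linear: every `g` acts as the restriction of a linear map of
`ℝ^(n+1)`. (Such a map preserves the unit sphere, so it is an orthogonal transformation.) -/
def IsLinearAction (G : Type*) [Group G] (n : ℕ) [MulAction G (UnitSphere n)] : Prop :=
  ∀ g : G, ∃ L : EuclideanSpace ℝ (Fin (n + 1)) →ₗ[ℝ] EuclideanSpace ℝ (Fin (n + 1)),
    ∀ x : UnitSphere n, ((g • x : UnitSphere n) : EuclideanSpace ℝ (Fin (n + 1))) = L x

end EquivariantTC

/-! Upper bounds. Let `q` be a fixed point. If finitely many invariant open sets contract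
equivariantly to `q` and every pair of points lies in one of them, their squares are motion planning
domains: run one contraction forwards and the other backwards. Three such sets suffice on the
sphere: the complement of `-q`, the complement of `q`, and the complement of the equator orthogonal
to `q`. The second contracts to `-q`, then follows a path of fixed points to `q`, given by
`G`-connectedness. The third is the disjoint union of two open hemispheres and catches the pairs
`(q, -q)` and `(-q, q)` missed by the others (`exists_contractible_cover`).

Lower bounds. A single planner on all of `X × X`, restricted to pairs `(x, q)`, contracts the sphere
to `q`. In the invariant case, equivariance under `(1, g)` makes the break point `G`-fixed, so the
two halves join to a genuine path.

The sphere is not contractible (`sphere_not_contractible`): a contraction would give a retraction of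
the ball, which can be made smooth. For such an `f` put `v = f - id`. The integral over the ball of
`det (1 + t Dv)` is polynomial in `t` and equals the volume for small `t > 0`, hence also at `t =
1`, where the integrand vanishes. -/

namespace EquivariantTC

/-! ### No smooth retraction onto the sphere: the volume argument. -/

section SmoothRetraction

variable {E : Type*} [NormedAddCommGroup E] [InnerProductSpace ℝ E]

/-- A Lipschitz map on the closed unit ball which vanishes on the unit sphere remains Lipschitz
when it is extended by zero. -/
theorem norm_indicator_ball_sub_le {v : E → E} {K : NNReal}
    (hK : LipschitzOnWith K v (Metric.closedBall 0 1)) (hv : ∀ x, ‖x‖ = 1 → v x = 0) (x y : E) :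
    ‖(Metric.ball (0 : E) 1).indicator v x - (Metric.ball (0 : E) 1).indicator v y‖ ≤
      K * ‖x - y‖ := by
  have key : ∀ a b : E, ‖a‖ < 1 → 1 ≤ ‖b‖ → ‖v a‖ ≤ K * ‖a - b‖ := by
    intro a b ha hb
    -- The sphere point nearest to `a` is its radial projection, at distance `1 - ‖a‖ ≤ ‖b‖ - ‖a‖`.
    -- For `a = 0` there is no direction, and that of `b` serves.
    obtain ⟨z, hz, hza⟩ : ∃ z : E, ‖z‖ = 1 ∧ ‖a - z‖ ≤ ‖a - b‖ := by
      have hab : ‖b‖ - ‖a‖ ≤ ‖a - b‖ := by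
        rw [norm_sub_rev]; exact norm_sub_norm_le _ _
      by_cases ha0 : a = 0
      · have hb0 : b ≠ 0 := by rintro rfl; simp at hb; linarith
        refine ⟨‖b‖⁻¹ • b, (norm_smul_inv_norm (𝕜 := ℝ) hb0), ?_⟩
        subst ha0
        simp only [zero_sub, norm_neg]
        exact (norm_smul_inv_norm (𝕜 := ℝ) hb0).le.trans hb
      · refine ⟨‖a‖⁻¹ • a, (norm_smul_inv_norm (𝕜 := ℝ) ha0), ?_⟩
        have hpos : 0 < ‖a‖ := norm_pos_iff.2 ha0
        have : a - ‖a‖⁻¹ • a = (1 - ‖a‖⁻¹) • a := by rw [sub_smul, one_smul]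
        rw [this, norm_smul, Real.norm_eq_abs, abs_sub_comm,
          abs_of_nonneg (sub_nonneg.2 ((one_le_inv₀ hpos).2 ha.le)), sub_mul,
          inv_mul_cancel₀ hpos.ne']
        linarith
    have := hK.norm_sub_le (x := a) (y := z) (by simpa using ha.le) (by simpa using hz.le)
    rw [hv z hz, sub_zero] at this
    exact this.trans (by gcongr)
  by_cases hx : ‖x‖ < 1 <;> by_cases hy : ‖y‖ < 1
  · rw [Set.indicator_of_mem (by simpa using hx), Set.indicator_of_mem (by simpa using hy)]
    exact hK.norm_sub_le (by simpa using hx.le) (by simpa using hy.le)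
  · rw [Set.indicator_of_mem (by simpa using hx), Set.indicator_of_notMem (by simpa using hy),
      sub_zero]
    exact key x y hx (not_lt.1 hy)
  · rw [Set.indicator_of_notMem (by simpa using hx), Set.indicator_of_mem (by simpa using hy),
      zero_sub, norm_neg, norm_sub_rev]
    exact key y x hy (not_lt.1 hx)
  · rw [Set.indicator_of_notMem (by simpa using hx), Set.indicator_of_notMem (by simpa using hy),
      sub_zero, norm_zero]
    positivity

variable [FiniteDimensional ℝ E]

/-- `det (1 + t A)` is a polynomial in `t` of degree at most the dimension. -/
theorem exists_polynomial_eval_eq_det (A : E →L[ℝ] E) :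
    ∃ p : Polynomial ℝ, p.natDegree ≤ Module.finrank ℝ E ∧
      ∀ t : ℝ, p.eval t = (1 + t • A : E →L[ℝ] E).det := by
  let b := Module.finBasis ℝ E
  let M := LinearMap.toMatrix b b (A : E →ₗ[ℝ] E)
  refine ⟨_, (Polynomial.natDegree_det_X_add_C_le M 1).trans_eq (Fintype.card_fin _),
    fun t => ?_⟩
  have hM : LinearMap.toMatrix b b ((1 + t • A : E →L[ℝ] E) : E →ₗ[ℝ] E) = t • M + 1 := by
    rw [ContinuousLinearMap.toLinearMap_add, ContinuousLinearMap.toLinearMap_smul, map_add,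
      map_smul, add_comm]
    congr 1
    exact LinearMap.toMatrix_one b
  have hdet : (1 + t • A : E →L[ℝ] E).det = (t • M + 1).det := by
    rw [← hM]
    exact (LinearMap.det_toMatrix b _).symm
  rw [hdet, ← Polynomial.coe_evalRingHom, RingHom.map_det]
  congr 1
  ext i j
  rcases eq_or_ne i j with rfl | hij
  · simp only [RingHom.mapMatrix_apply, Matrix.map_apply, Matrix.add_apply, Matrix.smul_apply,
      Matrix.one_apply_eq, smul_eq_mul, Polynomial.coe_evalRingHom, Polynomial.eval_add,
      Polynomial.eval_mul, Polynomial.eval_X, Polynomial.eval_C]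
  · simp only [RingHom.mapMatrix_apply, Matrix.map_apply, Matrix.add_apply, Matrix.smul_apply,
      Matrix.one_apply_ne hij, smul_eq_mul, Polynomial.coe_evalRingHom, Polynomial.eval_add,
      Polynomial.eval_mul, Polynomial.eval_X, Polynomial.eval_C]

/-- Lagrange interpolation of `det (1 + t A)` at the nodes `s`, evaluated at `t = 1`. -/
theorem det_one_add_eq_sum (A : E →L[ℝ] E) {s : Finset ℝ}
    (hs : s.card = Module.finrank ℝ E + 1) :
    (1 + A : E →L[ℝ] E).det =
      ∑ t ∈ s, (1 + t • A : E →L[ℝ] E).det * (Lagrange.basis s id t).eval 1 := by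
  obtain ⟨p, hp, hpe⟩ := exists_polynomial_eval_eq_det A
  have hdeg : p.degree < s.card :=
    Polynomial.degree_le_natDegree.trans_lt (by exact_mod_cast (by omega))
  have h := Lagrange.eq_interpolate_of_eval_eq (s := s) (v := id)
    (fun t => (1 + t • A : E →L[ℝ] E).det) (Set.injOn_id _) hdeg fun t _ => hpe t
  have h1 := hpe 1
  rw [one_smul] at h1
  rw [← h1]
  conv_lhs => rw [h]
  simp [Lagrange.interpolate_apply, Polynomial.eval_finsetSum]

/-- A differentiable map into the unit sphere has singular derivatives. -/
theorem det_eq_zero_of_norm_eq_one {f : E → E} {f' : E →L[ℝ] E} {x : E}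
    (hf : HasFDerivAt f f' x) (h1 : ∀ y, ‖f y‖ = 1) : f'.det = 0 := by
  by_contra hdet
  have hsurj : Function.Surjective (f' : E →ₗ[ℝ] E) :=
    (LinearMap.equivOfDetNeZero (f' : E →ₗ[ℝ] E) hdet).surjective
  -- Along this `u` the derivative of `‖f‖ ^ 2` is `2 * ‖f x‖ ^ 2 = 2`, yet that function is
  -- constant.
  obtain ⟨u, hu⟩ := hsurj (f x)
  have h2 : HasFDerivAt (fun y => ‖f y‖ ^ 2) _ x := hf.norm_sq
  have h3 : HasFDerivAt (fun y => ‖f y‖ ^ 2) (0 : E →L[ℝ] ℝ) x := by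
    simp only [h1]
    exact hasFDerivAt_const _ _
  have h4 := congrArg (fun T : E →L[ℝ] ℝ => T u) (h2.unique h3)
  have hu' : f' u = f x := hu
  simp [hu', h1] at h4

/-- A small Lipschitz perturbation of the identity inside the unit ball, vanishing on the unit
sphere and not leaving the ball, is a bijection of the unit ball. -/
theorem bijOn_ball_add_smul {v : E → E} {K : NNReal}
    (hK : LipschitzOnWith K v (Metric.closedBall 0 1)) (hv : ∀ x, ‖x‖ = 1 → v x = 0)
    {t : ℝ} (ht0 : 0 ≤ t) (htK : t * K < 1)
    (hmaps : Set.MapsTo (fun x => x + t • v x) (Metric.ball 0 1) (Metric.ball 0 1)) :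
    Set.BijOn (fun x => x + t • v x) (Metric.ball (0 : E) 1) (Metric.ball 0 1) := by
  set w := (Metric.ball (0 : E) 1).indicator v with hw
  set F : E → E := fun x => x + t • w x with hF
  -- `F` differs from the identity by a map of Lipschitz constant `t * K < 1`, so it is a bijection
  -- of the whole space. Being the identity off the ball, it takes no outside point into the ball.
  have happ : ApproximatesLinearOn F ((ContinuousLinearEquiv.refl ℝ E : E ≃L[ℝ] E) : E →L[ℝ] E)
      Set.univ (⟨t, ht0⟩ * K) := by
    rw [ApproximatesLinearOn.approximatesLinearOn_iff_lipschitzOnWith]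
    refine LipschitzOnWith.of_dist_le_mul fun x _ y _ => ?_
    have := norm_indicator_ball_sub_le hK hv x y
    simp only [dist_eq_norm, hF, Pi.sub_apply, ContinuousLinearEquiv.coe_coe,
      ContinuousLinearEquiv.refl_apply, add_sub_cancel_left, ← smul_sub, norm_smul,
      Real.norm_of_nonneg ht0]
    exact (mul_le_mul_of_nonneg_left this ht0).trans_eq (mul_assoc _ _ _).symm
  have hc : Subsingleton E ∨ ⟨t, ht0⟩ * K <
      ‖((ContinuousLinearEquiv.refl ℝ E).symm : E →L[ℝ] E)‖₊⁻¹ := by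
    rcases subsingleton_or_nontrivial E with h | h
    · exact Or.inl h
    · right
      have h1 : ‖((ContinuousLinearEquiv.refl ℝ E).symm : E →L[ℝ] E)‖₊ = 1 := by
        simp
      rw [h1, inv_one, ← NNReal.coe_lt_coe]
      exact htK
  have heq : Set.EqOn F (fun x => x + t • v x) (Metric.ball 0 1) := fun x hx => by
    simp only [hF, hw, Set.indicator_of_mem hx]
  refine ⟨hmaps, ((happ.injOn hc).mono (Set.subset_univ _)).congr heq, fun y hy => ?_⟩
  obtain ⟨x, hx⟩ := happ.surjective hc y
  have hxb : x ∈ Metric.ball (0 : E) 1 := by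
    by_contra h
    simp only [hF, hw, Set.indicator_of_notMem h, smul_zero, add_zero] at hx
    exact h (hx ▸ hy)
  exact ⟨x, hxb, (heq hxb).symm.trans hx⟩

/-- There is no smooth retraction onto the unit sphere (Milnor's and Rogers' volume argument). -/
theorem not_exists_smooth_retraction {f : E → E} (hf : ContDiff ℝ 1 f) (h1 : ∀ x, ‖f x‖ = 1)
    (hid : ∀ x, ‖x‖ = 1 → f x = x) : False := by
  borelize E
  set v : E → E := fun x => f x - x with hv
  have hvC : ContDiff ℝ 1 v := hf.sub contDiff_id
  have hv0 : ∀ x, ‖x‖ = 1 → v x = 0 := fun x hx => by simp [hv, hid x hx]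
  obtain ⟨K, hK⟩ := hvC.contDiffOn.exists_lipschitzOnWith one_ne_zero
    (convex_closedBall (0 : E) 1) (isCompact_closedBall _ _)
  have hcont : Continuous fun z : ℝ × E => (1 + z.1 • fderiv ℝ v z.2 : E →L[ℝ] E).det := by
    have := hvC.continuous_fderiv one_ne_zero
    exact ContinuousLinearMap.continuous_det.comp (by fun_prop)
  -- The determinant is 1 at `t = 0`; compactness of the closed ball makes the bound uniform in `x`.
  have hpos : ∀ᶠ t : ℝ in nhds 0, ∀ x ∈ Metric.closedBall (0 : E) 1,
      0 < (1 + t • fderiv ℝ v x : E →L[ℝ] E).det := by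
    refine (isCompact_closedBall (0 : E) 1).eventually_forall_of_forall_eventually
      (P := fun t x => 0 < (1 + t • fderiv ℝ v x : E →L[ℝ] E).det) fun x _ => ?_
    refine hcont.continuousAt.eventually_const_lt ?_
    simp [ContinuousLinearMap.det]
  have hsmall : ∀ᶠ t : ℝ in nhds 0, t * K < 1 :=
    (continuous_id.mul continuous_const).continuousAt.eventually_lt_const (by simp)
  obtain ⟨δ, hδ, hδt⟩ := Metric.eventually_nhds_iff.1 ((hpos.and hsmall).and (gt_mem_nhds one_pos))
  obtain ⟨s, hsub, hcard⟩ := (Set.Ioo_infinite hδ).exists_subset_card_eq (Module.finrank ℝ E + 1)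
  have hint : ∀ t : ℝ, MeasureTheory.IntegrableOn
      (fun x => (1 + t • fderiv ℝ v x : E →L[ℝ] E).det) (Metric.ball (0 : E) 1) := fun t =>
    ((hcont.comp (Continuous.prodMk_right t)).continuousOn.integrableOn_compact
      (isCompact_closedBall (0 : E) 1)).mono_set Metric.ball_subset_closedBall
  have hvol : ∀ t ∈ s, ∫ x in Metric.ball (0 : E) 1, (1 + t • fderiv ℝ v x : E →L[ℝ] E).det =
      (MeasureTheory.volume (Metric.ball (0 : E) 1)).toReal := by
    intro t ht
    obtain ⟨ht0, htδ⟩ := hsub ht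
    obtain ⟨⟨hdet, htK⟩, ht1⟩ := hδt (y := t) (by simpa [abs_of_pos ht0] using htδ)
    have hmaps : Set.MapsTo (fun x => x + t • v x) (Metric.ball (0 : E) 1) (Metric.ball 0 1) := by
      intro x hx
      rw [mem_ball_zero_iff] at hx ⊢
      have : x + t • v x = (1 - t) • x + t • f x := by simp only [hv]; module
      calc ‖x + t • v x‖ ≤ ‖(1 - t) • x‖ + ‖t • f x‖ := this ▸ norm_add_le _ _
        _ = (1 - t) * ‖x‖ + t := by
          rw [norm_smul, norm_smul, h1, Real.norm_of_nonneg (by linarith : (0 : ℝ) ≤ 1 - t),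
            Real.norm_of_nonneg ht0.le, mul_one]
        _ < 1 := by nlinarith
    have hb := bijOn_ball_add_smul hK hv0 ht0.le htK hmaps
    have hder : ∀ x ∈ Metric.ball (0 : E) 1, HasFDerivWithinAt (fun x => x + t • v x)
        (1 + t • fderiv ℝ v x : E →L[ℝ] E) (Metric.ball (0 : E) 1) x := fun x _ =>
      ((hasFDerivAt_id x).add
        ((hvC.differentiable one_ne_zero x).hasFDerivAt.const_smul t)).hasFDerivWithinAt
    have := MeasureTheory.integral_image_eq_integral_abs_det_fderiv_smul MeasureTheory.volume
      Metric.isOpen_ball.measurableSet hder hb.injOn (fun _ => (1 : ℝ))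
    rw [hb.image_eq] at this
    simp only [smul_eq_mul, mul_one, MeasureTheory.integral_const,
      MeasureTheory.measureReal_restrict_apply_univ] at this
    rw [← MeasureTheory.measureReal_def, this]
    refine MeasureTheory.setIntegral_congr_fun Metric.isOpen_ball.measurableSet fun x hx => ?_
    exact (abs_of_pos (hdet x (Metric.ball_subset_closedBall hx))).symm
  have hzero : ∀ x, (1 + fderiv ℝ v x : E →L[ℝ] E).det = 0 := fun x => by
    have h := ((hasFDerivAt_id x).add (hvC.differentiable one_ne_zero x).hasFDerivAt)
    refine det_eq_zero_of_norm_eq_one (f := f) (x := x) ?_ h1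
    have hfv : f = id + v := by ext y; simp [hv]
    rw [hfv]
    exact h
  -- Interpolating the integrand pointwise at small nodes extrapolates the volume identity to `t =
  -- 1`; the weights sum to 1.
  have hsum : (0 : ℝ) = ∑ t ∈ s, (MeasureTheory.volume (Metric.ball (0 : E) 1)).toReal *
      (Lagrange.basis s id t).eval 1 := by
    calc (0 : ℝ) = ∫ x in Metric.ball (0 : E) 1, (1 + fderiv ℝ v x : E →L[ℝ] E).det := by
          simp only [hzero, MeasureTheory.integral_zero]
      _ = ∫ x in Metric.ball (0 : E) 1, ∑ t ∈ s, (1 + t • fderiv ℝ v x : E →L[ℝ] E).det *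
            (Lagrange.basis s id t).eval 1 := by
          exact congrArg _ (funext fun x => det_one_add_eq_sum _ hcard)
      _ = ∑ t ∈ s, (∫ x in Metric.ball (0 : E) 1, (1 + t • fderiv ℝ v x : E →L[ℝ] E).det) *
            (Lagrange.basis s id t).eval 1 := by
          rw [MeasureTheory.integral_finsetSum _ fun t _ => (hint t).mul_const _]
          simp only [MeasureTheory.integral_mul_const]
      _ = _ := Finset.sum_congr rfl fun t ht => by rw [hvol t ht]
  rw [← Finset.mul_sum, ← Polynomial.eval_finsetSum, Lagrange.sum_basis (Set.injOn_id _)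
    (Finset.card_pos.1 (by omega)), Polynomial.eval_one, mul_one] at hsum
  exact (ENNReal.toReal_pos (Metric.measure_ball_pos _ _ one_pos).ne'
    MeasureTheory.measure_ball_lt_top.ne).ne hsum

end SmoothRetraction

end EquivariantTC

namespace EquivariantTC

/-! ### From a contraction of the sphere to a smooth retraction. -/

section Contraction

variable {E : Type*} [NormedAddCommGroup E] [InnerProductSpace ℝ E]

/-- The radial projection to the unit sphere; the origin is sent to `p`. -/
noncomputable def sphereProj (p : Metric.sphere (0 : E) 1) (x : E) : Metric.sphere (0 : E) 1 :=
  open Classical in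
  if hx : x = 0 then p else ⟨‖x‖⁻¹ • x, by simpa using norm_smul_inv_norm (𝕜 := ℝ) hx⟩

theorem coe_sphereProj (p : Metric.sphere (0 : E) 1) {x : E} (hx : x ≠ 0) :
    (sphereProj p x : E) = ‖x‖⁻¹ • x := by
  simp only [sphereProj, dif_neg hx]

theorem sphereProj_coe (p x : Metric.sphere (0 : E) 1) : sphereProj p (x : E) = x :=
  Subtype.ext (by
    rw [coe_sphereProj p (ne_zero_of_mem_unit_sphere x), norm_eq_of_mem_sphere, inv_one, one_smul])

theorem continuousAt_sphereProj (p : Metric.sphere (0 : E) 1) {x : E} (hx : x ≠ 0) :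
    ContinuousAt (sphereProj p) x := by
  rw [Topology.IsInducing.subtypeVal.continuousAt_iff]
  have h : ContinuousAt (fun y : E => ‖y‖⁻¹ • y) x :=
    (continuous_norm.continuousAt.inv₀ (norm_ne_zero_iff.2 hx)).smul continuousAt_id
  refine h.congr ?_
  filter_upwards [isOpen_ne.mem_nhds hx] with y hy
  exact (coe_sphereProj p hy).symm

variable [FiniteDimensional ℝ E]

/-- There is no continuous map into the unit sphere which is the radial projection near and outside
of the unit sphere. -/
theorem not_exists_continuous_retraction {r : E → E} (hr : Continuous r) (h1 : ∀ x, ‖r x‖ = 1)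
    (hid : ∀ x, 1 / 2 ≤ ‖x‖ → r x = ‖x‖⁻¹ • x) : False := by
  -- `r` is already smooth near `3 / 4 ≤ ‖x‖`, so the smoothing can leave it unchanged there, in
  -- particular on the unit sphere.
  have hU : {x : E | 1 / 2 < ‖x‖} ∈ nhdsSet {x : E | 3 / 4 ≤ ‖x‖} :=
    (isOpen_lt continuous_const continuous_norm).mem_nhdsSet.2 fun x hx => by
      simp only [Set.mem_ofPred_eq] at hx ⊢
      linarith
  have hrU : ContDiffOn ℝ ((1 : ℕ∞) : WithTop ℕ∞) r {x : E | 1 / 2 < ‖x‖} := by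
    refine ContDiffOn.congr (f := fun x => ‖x‖⁻¹ • x) (fun x hx => ?_) fun x hx => hid x (le_of_lt hx)
    have hx0 : x ≠ 0 := by
      rintro rfl
      simp only [Set.mem_ofPred_eq, norm_zero] at hx
      linarith
    exact (((contDiffAt_norm ℝ hx0).inv (norm_ne_zero_iff.2 hx0)).smul
      contDiffAt_id).contDiffWithinAt
  obtain ⟨g, hg, hgr, hgS, -⟩ := hr.exists_contDiff_approx_and_eqOn 1
    (ε := fun _ => 1) continuous_const (fun _ => one_pos)
    (isClosed_le continuous_const continuous_norm) hU hrU
  -- An error below 1 cannot bring a unit vector to zero, so `g` can be normalized.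
  have hg0 : ∀ x, g x ≠ 0 := fun x h => by
    have := hgr x
    rw [h, dist_zero_left, h1] at this
    exact lt_irrefl _ this
  refine not_exists_smooth_retraction (f := fun x => ‖g x‖⁻¹ • g x) ?_
    (fun x => norm_smul_inv_norm (𝕜 := ℝ) (hg0 x)) fun x hx => ?_
  · exact ((hg.norm ℝ hg0).inv fun x => norm_ne_zero_iff.2 (hg0 x)).smul hg
  · have : g x = x := by
      rw [hgS (by simp only [Set.mem_ofPred_eq]; linarith), hid x (by linarith), hx, inv_one,
        one_smul]
    simp [this, hx]

/-- The unit sphere is not contractible. -/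
theorem sphere_not_contractible {p : Metric.sphere (0 : E) 1}
    (H : Metric.sphere (0 : E) 1 → I → Metric.sphere (0 : E) 1)
    (hH : Continuous (Function.uncurry H)) (h0 : ∀ x, H x 0 = x) (h1 : ∀ x, H x 1 = p) : False := by
  -- The contraction is complete once `‖x‖ ≤ 1 / 4`, which hides the discontinuity of `sphereProj`
  -- at the origin, and has not begun for `‖x‖ ≥ 1 / 2`.
  let τ : E → I := fun x => Set.projIcc 0 1 zero_le_one (2 - 4 * ‖x‖)
  have hτ : Continuous τ := continuous_projIcc.comp (by fun_prop)
  have hτ1 : ∀ x, ‖x‖ ≤ 1 / 4 → τ x = 1 := fun x hx =>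
    Set.projIcc_of_right_le _ (by linarith)
  have hτ0 : ∀ x, 1 / 2 ≤ ‖x‖ → τ x = 0 := fun x hx =>
    Set.projIcc_of_le_left _ (by linarith)
  refine not_exists_continuous_retraction (r := fun x => (H (sphereProj p x) (τ x) : E)) ?_
    (fun x => norm_eq_of_mem_sphere _) fun x hx => ?_
  · rw [continuous_iff_continuousAt]
    intro x
    by_cases hx : x = 0
    · have : (fun x => (H (sphereProj p x) (τ x) : E)) =ᶠ[nhds x] fun _ => (p : E) := by
        filter_upwards [continuous_norm.continuousAt.eventually_lt_const
          (show ‖x‖ < 1 / 4 by simp [hx])] with y hy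
        rw [hτ1 y hy.le, h1]
      exact continuousAt_const.congr this.symm
    · exact continuous_subtype_val.continuousAt.comp
        (hH.continuousAt.comp (f := fun x => (sphereProj p x, τ x)) ((continuousAt_sphereProj p hx).prodMk hτ.continuousAt))
  · have hx0 : x ≠ 0 := by
      rintro rfl
      rw [norm_zero] at hx
      linarith
    rw [hτ0 x hx, h0, coe_sphereProj p hx0]

end Contraction

end EquivariantTC

namespace EquivariantTC

/-! ### Equivariant contractions and motion planners. -/

section Planners

variable {G X : Type*} [Group G] [TopologicalSpace X] [MulAction G X]

/-- `A` is an open invariant set which can be contracted equivariantly, inside `X`, to `q`. -/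
def IsContractibleTo (G : Type*) {X : Type*} [Group G] [TopologicalSpace X] [MulAction G X]
    (A : Set X) (q : X) : Prop :=
  IsOpen A ∧ (∀ g : G, ∀ x ∈ A, g • x ∈ A) ∧
    ∃ c : (x : A) → Path (x : X) q, Continuous (fun z : A × I => c z.1 z.2) ∧
      ∀ (g : G) (x : A) (hx : g • (x : X) ∈ A) (t : I), c ⟨g • (x : X), hx⟩ t = g • c x t

theorem IsContractibleTo.mono {A B : Set X} {q : X} (h : IsContractibleTo G A q) (hBA : B ⊆ A)
    (hB : IsOpen B) (hinv : ∀ g : G, ∀ x ∈ B, g • x ∈ B) : IsContractibleTo G B q := by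
  obtain ⟨-, -, c, hc, he⟩ := h
  exact ⟨hB, hinv, fun x => c ⟨x, hBA x.2⟩,
    hc.comp (((continuous_inclusion hBA).comp continuous_fst).prodMk continuous_snd),
    fun g x hx t => he g ⟨x, hBA x.2⟩ (hBA hx) t⟩

theorem IsContractibleTo.trans {A : Set X} {q r : X} (h : IsContractibleTo G A q) (α : Path q r)
    (hα : ∀ (g : G) (t : I), g • α t = α t) : IsContractibleTo G A r := by
  obtain ⟨hA, hinv, c, hc, he⟩ := h
  refine ⟨hA, hinv, fun x => (c x).trans α,
    Path.trans_continuous_family c hc (fun _ => α) (α.continuous.comp continuous_snd),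
    fun g x hx t => ?_⟩
  simp only [Path.trans_apply]
  split_ifs
  · exact he g x hx _
  · exact (hα g _).symm

/-- Both pieces are open, so contractions chosen separately glue continuously; the union need not be
connected. -/
theorem IsContractibleTo.union {A B : Set X} {q : X} (hA : IsContractibleTo G A q)
    (hB : IsContractibleTo G B q) (hAB : Disjoint A B) : IsContractibleTo G (A ∪ B) q := by
  classical
  obtain ⟨hAo, hAi, c, hc, hce⟩ := hA
  obtain ⟨hBo, hBi, d, hd, hde⟩ := hB
  let e : (x : ↥(A ∪ B)) → Path (x : X) q := fun x =>
    if hx : (x : X) ∈ A then c ⟨x, hx⟩ else d ⟨x, x.2.resolve_left hx⟩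
  have heA : ∀ (x : ↥(A ∪ B)) (hx : (x : X) ∈ A) (t : I), e x t = c ⟨x, hx⟩ t :=
    fun x hx t => by simp only [e, dif_pos hx]
  have heB : ∀ (x : ↥(A ∪ B)) (hx : (x : X) ∈ B) (t : I), e x t = d ⟨x, hx⟩ t :=
    fun x hx t => by simp only [e, dif_neg (Set.disjoint_right.1 hAB hx)]
  refine ⟨hAo.union hBo, fun g x hx => hx.imp (hAi g x) (hBi g x), e, ?_, fun g x hx t => ?_⟩
  · rw [continuous_iff_continuousAt]
    rintro ⟨⟨x, hx | hx⟩, t⟩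
    · have hemb : Topology.IsOpenEmbedding
          (Prod.map (Set.inclusion (Set.subset_union_left : A ⊆ A ∪ B)) (id : I → I)) :=
        (Topology.IsOpenEmbedding.inclusion _ (hAo.preimage continuous_subtype_val)).prodMap .id
      refine (hemb.continuousAt_iff (x := (⟨x, hx⟩, t))).1 ?_
      refine hc.continuousAt.congr (Filter.Eventually.of_forall fun z => ?_)
      exact (heA (Set.inclusion Set.subset_union_left z.1) z.1.2 z.2).symm
    · have hemb : Topology.IsOpenEmbedding
          (Prod.map (Set.inclusion (Set.subset_union_right : B ⊆ A ∪ B)) (id : I → I)) :=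
        (Topology.IsOpenEmbedding.inclusion _ (hBo.preimage continuous_subtype_val)).prodMap .id
      refine (hemb.continuousAt_iff (x := (⟨x, hx⟩, t))).1 ?_
      refine hd.continuousAt.congr (Filter.Eventually.of_forall fun z => ?_)
      exact (heB (Set.inclusion Set.subset_union_right z.1) z.1.2 z.2).symm
  · obtain ⟨x, hx' | hx'⟩ := x
    · rw [heA _ (hAi g x hx'), heA _ hx']
      exact hce g ⟨x, hx'⟩ _ t
    · rw [heB _ (hBi g x hx'), heB _ hx']
      exact hde g ⟨x, hx'⟩ _ t

variable [ContinuousConstSMul G X]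

theorem IsContractibleTo.isEquivariantDomain {A : Set X} {q : X} (h : IsContractibleTo G A q) :
    IsEquivariantDomain G X (A ×ˢ A) := by
  obtain ⟨hA, hinv, c, hc, he⟩ := h
  let γ : (z : ↥(A ×ˢ A)) → Path (z : X × X).1 (z : X × X).2 := fun z =>
    (c ⟨(z : X × X).1, z.2.1⟩).trans (c ⟨(z : X × X).2, z.2.2⟩).symm
  have hγ : Continuous (fun w : ↥(A ×ˢ A) × I => γ w.1 w.2) := by
    refine Path.trans_continuous_family (ι := ↥(A ×ˢ A)) (fun z => c ⟨(z : X × X).1, z.2.1⟩)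
      (hc.comp (by fun_prop : Continuous fun w : ↥(A ×ˢ A) × I =>
        ((⟨(w.1 : X × X).1, w.1.2.1⟩ : A), w.2))) _
      (Path.symm_continuous_family (ι := ↥(A ×ˢ A)) (fun z => c ⟨(z : X × X).2, z.2.2⟩)
      (hc.comp (by fun_prop : Continuous fun w : ↥(A ×ˢ A) × I =>
        ((⟨(w.1 : X × X).2, w.1.2.2⟩ : A), w.2))))
  refine ⟨hA.prod hA, fun g z hz => ⟨hinv g _ hz.1, hinv g _ hz.2⟩,
    ⟨fun z => (γ z : C(I, X)), ContinuousMap.continuous_of_continuous_uncurry _ hγ⟩,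
    fun z => Prod.ext (γ z).source (γ z).target, fun g z hz => ?_⟩
  ext t
  change γ _ t = g • γ z t
  simp only [γ, Path.trans_apply, Path.symm_apply]
  split_ifs
  · exact he g ⟨(z : X × X).1, z.2.1⟩ hz.1 _
  · exact he g ⟨(z : X × X).2, z.2.2⟩ hz.2 _

/-- Breaking the path at `q` lets the two factors of `G × G` act independently on the two halves. -/
theorem IsContractibleTo.isInvariantDomain {A : Set X} {q : X} (h : IsContractibleTo G A q) :
    IsInvariantDomain G X (A ×ˢ A) := by
  obtain ⟨hA, hinv, c, hc, he⟩ := h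
  let s : ↥(A ×ˢ A) → BrokenPathSpace G X := fun z =>
    ⟨((c ⟨(z : X × X).1, z.2.1⟩ : C(I, X)), ((c ⟨(z : X × X).2, z.2.2⟩).symm : C(I, X))), by simp⟩
  have hs : Continuous s := by
    refine Continuous.subtype_mk (.prodMk ?_ ?_) _
    · refine ContinuousMap.continuous_of_continuous_uncurry _ ?_
      exact hc.comp (by fun_prop : Continuous fun w : ↥(A ×ˢ A) × I =>
        ((⟨(w.1 : X × X).1, w.1.2.1⟩ : A), w.2))
    · refine ContinuousMap.continuous_of_continuous_uncurry _ ?_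
      exact hc.comp (by fun_prop : Continuous fun w : ↥(A ×ˢ A) × I =>
        ((⟨(w.1 : X × X).2, w.1.2.2⟩ : A), σ w.2))
  refine ⟨hA.prod hA, fun g z hz => ⟨hinv _ _ hz.1, hinv _ _ hz.2⟩, ⟨s, hs⟩,
    fun z => Prod.ext (by simp [s]) (by simp [s]), fun g z hz => ?_⟩
  refine Subtype.ext (Prod.ext (ContinuousMap.ext fun t => ?_) (ContinuousMap.ext fun t => ?_))
  · exact he g.1 ⟨(z : X × X).1, z.2.1⟩ hz.1 t
  · exact he g.2 ⟨(z : X × X).2, z.2.2⟩ hz.2 (σ t)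

theorem equivariantTC_le_of_isContractibleTo {k : ℕ} (hk : 1 ≤ k) {q : X} (A : Fin k → Set X)
    (hA : ∀ i, IsContractibleTo G (A i) q) (hcover : ∀ x y, ∃ i, x ∈ A i ∧ y ∈ A i) :
    equivariantTC G X ≤ k :=
  sInf_le ⟨k, rfl, hk, fun i => A i ×ˢ A i,
    Set.eq_univ_of_forall fun z => Set.mem_iUnion.2 (hcover z.1 z.2),
    fun i => (hA i).isEquivariantDomain⟩

theorem invariantTC_le_of_isContractibleTo {k : ℕ} (hk : 1 ≤ k) {q : X} (A : Fin k → Set X)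
    (hA : ∀ i, IsContractibleTo G (A i) q) (hcover : ∀ x y, ∃ i, x ∈ A i ∧ y ∈ A i) :
    invariantTC G X ≤ k :=
  sInf_le ⟨k, rfl, hk, fun i => A i ×ˢ A i,
    Set.eq_univ_of_forall fun z => Set.mem_iUnion.2 (hcover z.1 z.2),
    fun i => (hA i).isInvariantDomain⟩

theorem IsEquivariantDomain.exists_contraction (h : IsEquivariantDomain G X Set.univ) (q : X) :
    ∃ H : X → I → X, Continuous (Function.uncurry H) ∧ (∀ x, H x 0 = x) ∧ ∀ x, H x 1 = q := by
  obtain ⟨-, -, s, hs, -⟩ := h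
  refine ⟨fun x => s ⟨(x, q), trivial⟩, ?_, fun x => congrArg Prod.fst (hs ⟨(x, q), trivial⟩),
    fun x => congrArg Prod.snd (hs ⟨(x, q), trivial⟩)⟩
  exact ContinuousMap.continuous_uncurry_of_continuous
    ⟨fun x : X => s ⟨(x, q), trivial⟩, s.continuous.comp (by fun_prop)⟩

theorem IsInvariantDomain.exists_contraction (h : IsInvariantDomain G X Set.univ) {q : X}
    (hq : q ∈ MulAction.fixedPoints G X) :
    ∃ H : X → I → X, Continuous (Function.uncurry H) ∧ (∀ x, H x 0 = x) ∧ ∀ x, H x 1 = q := by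
  obtain ⟨-, -, s, hs, he⟩ := h
  let u : X → (Set.univ : Set (X × X)) := fun x => ⟨(x, q), trivial⟩
  have hu : Continuous u := by fun_prop
  -- `(1, g)` fixes the pair `(x, q)`, hence also its broken path; its second half therefore starts
  -- at a fixed point, whose orbit is a single point.
  have hfix : ∀ x (g : G), g • (s (u x)).1.2 0 = (s (u x)).1.2 0 := fun x g => by
    have h1 := he (1, g) (u x) trivial
    have h2 : (⟨((1 : G) • x, g • q), trivial⟩ : (Set.univ : Set (X × X))) = u x :=
      Subtype.ext (Prod.ext (one_smul G x) (hq g))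
    have h3 : s (u x) = ((1, g) : G × G) • s (u x) := (congrArg s h2).symm.trans h1
    exact (congrArg (fun p : BrokenPathSpace G X => p.1.2 0) h3).symm
  have hmid : ∀ x, (s (u x)).1.1 1 = (s (u x)).1.2 0 := fun x => by
    have h1 : (s (u x)).1.1 1 ∈ MulAction.orbit G ((s (u x)).1.2 0) :=
      (s (u x)).2 ▸ MulAction.mem_orbit_self _
    obtain ⟨g, hg⟩ := h1
    exact hg.symm.trans (hfix x g)
  let γ : (x : X) → Path x ((s (u x)).1.2 0) := fun x =>
    ⟨(s (u x)).1.1, congrArg Prod.fst (hs (u x)), hmid x⟩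
  let δ : (x : X) → Path ((s (u x)).1.2 0) q := fun x =>
    ⟨(s (u x)).1.2, rfl, congrArg Prod.snd (hs (u x))⟩
  have hγ : Continuous fun z : X × I => γ z.1 z.2 :=
    ContinuousMap.continuous_uncurry_of_continuous
      ⟨fun x : X => (s (u x)).1.1, by fun_prop⟩
  have hδ : Continuous fun z : X × I => δ z.1 z.2 :=
    ContinuousMap.continuous_uncurry_of_continuous
      ⟨fun x : X => (s (u x)).1.2, by fun_prop⟩
  exact ⟨fun x => (γ x).trans (δ x), Path.trans_continuous_family γ hγ δ hδ,
    fun x => ((γ x).trans (δ x)).source, fun x => ((γ x).trans (δ x)).target⟩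

theorem two_le_equivariantTC (h : ¬ IsEquivariantDomain G X Set.univ) :
    2 ≤ equivariantTC G X := by
  refine le_sInf ?_
  rintro m ⟨k, rfl, hk, U, hU, hd⟩
  by_contra hlt
  obtain rfl : k = 1 := by
    have : k < 2 := by exact_mod_cast not_le.1 hlt
    omega
  have h0 : U 0 = Set.univ := (ciSup_unique (s := U)).symm.trans hU
  exact h (h0 ▸ hd 0)

theorem two_le_invariantTC (h : ¬ IsInvariantDomain G X Set.univ) :
    2 ≤ invariantTC G X := by
  refine le_sInf ?_
  rintro m ⟨k, rfl, hk, U, hU, hd⟩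
  by_contra hlt
  obtain rfl : k = 1 := by
    have : k < 2 := by exact_mod_cast not_le.1 hlt
    omega
  have h0 : U 0 = Set.univ := (ciSup_unique (s := U)).symm.trans hU
  exact h (h0 ▸ hd 0)

end Planners

end EquivariantTC

namespace EquivariantTC

/-! ### The three contractible sets on a linear sphere. -/

section LinearSphere

variable {G : Type*} [Group G] {n : ℕ} [MulAction G (UnitSphere n)]

/-- Each element of a group acting linearly on the unit sphere acts by a linear isometry. -/
theorem IsLinearAction.exists_linearIsometry (hlin : IsLinearAction G n) (g : G) :
    ∃ L : EuclideanSpace ℝ (Fin (n + 1)) →ₗᵢ[ℝ] EuclideanSpace ℝ (Fin (n + 1)),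
      ∀ x : UnitSphere n, ((g • x : UnitSphere n) : EuclideanSpace ℝ (Fin (n + 1))) = L x := by
  obtain ⟨L, hL⟩ := hlin g
  refine ⟨⟨L, fun v => ?_⟩, hL⟩
  by_cases hv : v = 0
  · simp [hv]
  · have hv' : ‖‖v‖⁻¹ • v‖ = 1 := norm_smul_inv_norm (𝕜 := ℝ) hv
    have h1 := norm_eq_of_mem_sphere (g • (⟨‖v‖⁻¹ • v, by simpa using hv'⟩ : UnitSphere n))
    rw [hL, map_smul, norm_smul, norm_inv, norm_norm] at h1
    have := norm_ne_zero_iff.2 hv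
    field_simp at h1
    exact h1

theorem IsLinearAction.smul_neg (hlin : IsLinearAction G n) (g : G) (x : UnitSphere n) :
    g • (-x) = -(g • x) := by
  obtain ⟨L, hL⟩ := hlin.exists_linearIsometry g
  exact Subtype.ext (by simp only [hL, coe_neg_sphere, map_neg])

/-- Two unit vectors cancel only with weights of equal absolute value, which forces `t = 1 / 2` and
`x = -q`. -/
theorem add_smul_ne_zero {x q : UnitSphere n} (hx : x ≠ -q) (t : ℝ) :
    (1 - t) • (x : EuclideanSpace ℝ (Fin (n + 1))) + t • (q : EuclideanSpace ℝ (Fin (n + 1))) ≠ 0 := by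
  intro h
  have h1 := eq_neg_of_add_eq_zero_left h
  have h2 := congrArg norm h1
  rw [norm_neg, norm_smul, norm_smul, norm_eq_of_mem_sphere, norm_eq_of_mem_sphere, mul_one,
    mul_one, Real.norm_eq_abs, Real.norm_eq_abs, abs_eq_abs] at h2
  have ht : t = 1 / 2 := by rcases h2 with h2 | h2 <;> linarith
  subst ht
  refine hx (Subtype.ext ?_)
  rw [coe_neg_sphere]
  have h3 := congrArg (fun v => (2 : ℝ) • v) h1
  simp only [smul_neg, smul_smul] at h3
  norm_num at h3
  exact h3

/-- The complement of the antipode of a fixed point contracts to the fixed point. -/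
theorem IsLinearAction.isContractibleTo_ne_neg (hlin : IsLinearAction G n) {q : UnitSphere n}
    (hq : ∀ g : G, g • q = q) : IsContractibleTo G {x : UnitSphere n | x ≠ -q} q := by
  have hcont : ∀ z : {x : UnitSphere n | x ≠ -q} × I, ContinuousAt
      (fun z : {x : UnitSphere n | x ≠ -q} × I => sphereProj q
        ((1 - (z.2 : ℝ)) • ((z.1 : UnitSphere n) : EuclideanSpace ℝ (Fin (n + 1))) +
          (z.2 : ℝ) • (q : EuclideanSpace ℝ (Fin (n + 1))))) z := fun z =>
    (continuousAt_sphereProj q (add_smul_ne_zero z.1.2 z.2)).comp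
      (f := fun z : {x : UnitSphere n | x ≠ -q} × I =>
        (1 - (z.2 : ℝ)) • ((z.1 : UnitSphere n) : EuclideanSpace ℝ (Fin (n + 1))) +
          (z.2 : ℝ) • (q : EuclideanSpace ℝ (Fin (n + 1)))) (by fun_prop)
  have hc := continuous_iff_continuousAt.2 hcont
  refine ⟨isOpen_ne, fun g x hx h => hx ?_, fun x =>
    { toFun := fun t => sphereProj q
        ((1 - (t : ℝ)) • ((x : UnitSphere n) : EuclideanSpace ℝ (Fin (n + 1))) +
          (t : ℝ) • (q : EuclideanSpace ℝ (Fin (n + 1))))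
      continuous_toFun := hc.comp (Continuous.prodMk_right x)
      source' := by simp [sphereProj_coe]
      target' := by simp [sphereProj_coe] }, hc, fun g x hx t => ?_⟩
  · have h1 : g • x = g • (-q) := by rw [h, hlin.smul_neg, hq]
    exact (MulAction.injective g) h1
  · obtain ⟨L, hL⟩ := hlin.exists_linearIsometry g
    refine Subtype.ext ?_
    have hLq : L q = q := by rw [← hL, hq]
    change (sphereProj q _ : EuclideanSpace ℝ (Fin (n + 1))) =
      ((g • sphereProj q _ : UnitSphere n) : EuclideanSpace ℝ (Fin (n + 1)))
    -- A linear isometry fixing `q` carries the segment from `x` to `q` onto that from `g • x` to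
    -- `q` and commutes with normalization.
    have hw : L ((1 - (t : ℝ)) • ((x : UnitSphere n) : EuclideanSpace ℝ (Fin (n + 1))) +
        (t : ℝ) • (q : EuclideanSpace ℝ (Fin (n + 1)))) =
        (1 - (t : ℝ)) • ((g • (x : UnitSphere n) : UnitSphere n) :
          EuclideanSpace ℝ (Fin (n + 1))) + (t : ℝ) • (q : EuclideanSpace ℝ (Fin (n + 1))) := by
      rw [map_add, map_smul, map_smul, hLq, ← hL]
    rw [coe_sphereProj q (add_smul_ne_zero hx t), ← hw, L.norm_map, hL,
      coe_sphereProj q (add_smul_ne_zero x.2 t), map_smul]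

/-- Three contractible sets, such that every pair of points lies in one of them. -/
theorem IsLinearAction.exists_contractible_cover (hlin : IsLinearAction G n)
    (hconn : GConnected G (UnitSphere n)) {q : UnitSphere n} (hq : ∀ g : G, g • q = q) :
    ∃ A : Fin 3 → Set (UnitSphere n), (∀ i, IsContractibleTo G (A i) q) ∧
      ∀ x y, ∃ i, x ∈ A i ∧ y ∈ A i := by
  have hnq : ∀ g : G, g • (-q) = -q := fun g => by rw [hlin.smul_neg, hq]
  have hmem : ∀ {x : UnitSphere n}, (∀ g : G, g • x = x) →
      x ∈ MulAction.fixedPoints (⊤ : Subgroup G) (UnitSphere n) := fun hx g => hx g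
  obtain ⟨α, hα⟩ := (hconn ⊤ ⟨q, hmem hq⟩).joinedIn (-q) (hmem hnq) q (hmem hq)
  have hα' : ∀ (g : G) (t : I), g • α t = α t := fun g t => hα t ⟨g, trivial⟩
  have hU := hlin.isContractibleTo_ne_neg hq
  have hV : IsContractibleTo G {x : UnitSphere n | x ≠ q} q := by
    have := (hlin.isContractibleTo_ne_neg hnq).trans α hα'
    rwa [neg_neg] at this
  let h : UnitSphere n → ℝ := fun x => inner ℝ (x : EuclideanSpace ℝ (Fin (n + 1))) q
  have hh : Continuous h := by fun_prop
  have hqq : h q = 1 := by simp [h]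
  have hnqq : h (-q) = -1 := by simp [h, inner_neg_left]
  have hinv : ∀ (g : G) (x : UnitSphere n), h (g • x) = h x := fun g x => by
    obtain ⟨L, hL⟩ := hlin.exists_linearIsometry g
    have hLq : L q = q := by rw [← hL, hq]
    calc h (g • x) = inner ℝ (L x) (L q) := by rw [hLq, ← hL]
      _ = h x := L.inner_map_map _ _
  have hW : IsContractibleTo G ({x : UnitSphere n | 0 < h x} ∪ {x : UnitSphere n | h x < 0}) q := by
    refine (hU.mono ?_ (isOpen_lt continuous_const hh) fun g x hx => ?_).union
      (hV.mono ?_ (isOpen_lt hh continuous_const) fun g x hx => ?_) ?_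
    · rintro _ hx rfl
      rw [Set.mem_ofPred_eq, hnqq] at hx
      linarith
    · rwa [Set.mem_ofPred_eq, hinv]
    · rintro _ hx rfl
      rw [Set.mem_ofPred_eq, hqq] at hx
      linarith
    · rwa [Set.mem_ofPred_eq, hinv]
    · exact Set.disjoint_left.2 fun x (hx : 0 < h x) (hx' : h x < 0) => lt_asymm hx hx'
  have hqW : q ∈ {x : UnitSphere n | 0 < h x} ∪ {x : UnitSphere n | h x < 0} :=
    Or.inl (by rw [Set.mem_ofPred_eq, hqq]; exact one_pos)
  have hnqW : -q ∈ {x : UnitSphere n | 0 < h x} ∪ {x : UnitSphere n | h x < 0} :=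
    Or.inr (by rw [Set.mem_ofPred_eq, hnqq]; exact neg_one_lt_zero)
  refine ⟨![{x | x ≠ -q}, {x | x ≠ q}, {x | 0 < h x} ∪ {x | h x < 0}], Fin.forall_fin_succ.2 ⟨hU, Fin.forall_fin_two.2 ⟨hV, hW⟩⟩, fun x y => ?_⟩
  have hqne : q ≠ -q := fun h' => by
    have := congrArg h h'
    rw [hqq, hnqq] at this
    linarith
  by_cases h1 : x ≠ -q ∧ y ≠ -q
  · exact ⟨0, h1⟩
  by_cases h2 : x ≠ q ∧ y ≠ q
  · exact ⟨1, h2⟩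
  refine ⟨2, ?_⟩
  -- A pair missed by the first two sets contains both `q` and `-q`, and both lie off the equator.
  simp only [not_and_or, not_not] at h1 h2
  rcases h1 with h1 | h1 <;> rcases h2 with h2 | h2
  · exact absurd (h2.symm.trans h1) hqne
  · exact ⟨by rw [h1]; exact hnqW, by rw [h2]; exact hqW⟩
  · exact ⟨by rw [h2]; exact hqW, by rw [h1]; exact hnqW⟩
  · exact absurd (h2.symm.trans h1) hqne

end LinearSphere

end EquivariantTC

theorem mainTheorem5 (G : Type*) [Group G] [Finite G] (n : ℕ)
    [MulAction G (EquivariantTC.UnitSphere n)]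
    [ContinuousConstSMul G (EquivariantTC.UnitSphere n)]
    (hlin : EquivariantTC.IsLinearAction G n)
    (hconn : EquivariantTC.GConnected G (EquivariantTC.UnitSphere n))
    (hfix : (MulAction.fixedPoints G (EquivariantTC.UnitSphere n)).Nonempty) :
    (2 ≤ EquivariantTC.equivariantTC G (EquivariantTC.UnitSphere n) ∧
      EquivariantTC.equivariantTC G (EquivariantTC.UnitSphere n) ≤ 3) ∧
    (2 ≤ EquivariantTC.invariantTC G (EquivariantTC.UnitSphere n) ∧
      EquivariantTC.invariantTC G (EquivariantTC.UnitSphere n) ≤ 3) := by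
  obtain ⟨q, hq⟩ := hfix
  obtain ⟨A, hA, hcover⟩ := hlin.exists_contractible_cover hconn hq
  refine ⟨⟨EquivariantTC.two_le_equivariantTC fun h => ?_, ?_⟩,
    EquivariantTC.two_le_invariantTC fun h => ?_, ?_⟩
  · obtain ⟨H, hH, h0, h1⟩ := h.exists_contraction q
    exact EquivariantTC.sphere_not_contractible H hH h0 h1
  · exact EquivariantTC.equivariantTC_le_of_isContractibleTo (k := 3) (by norm_num) A hA hcover
  · obtain ⟨H, hH, h0, h1⟩ := h.exists_contraction hq
    exact EquivariantTC.sphere_not_contractible H hH h0 h1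
  · exact EquivariantTC.invariantTC_le_of_isContractibleTo (k := 3) (by norm_num) A hA hcover
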